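/- Let $X$ be a complex Banach space and let $T : X \to X$ be a bounded linear operator. Let $\lambda \in \mathbb{C}$ be a point of the topological boundary $\partial\sigma(T)$ of the spectrum of $T$ that is not an eigenvalue of $T$. Then for every $\varepsilon > 0$ there is a norm-closed linear subspace $Y_\varepsilon \subseteq X$ such that - $Y_\varepsilon$ is a half-space: both $Y_\varepsilon$ and the quotient $X / Y_\varepsilon$ are infinite-dimensional; - $Y_\varepsilon$ is almost-invariant under $T$: there is a finite-dimensional subspace $M \subseteq X$ with $T Y_\varepsilon \subseteq Y_\varepsilon + M$; - the restriction $(T - \lambda I)|_{Y_\varepsilon} : Y_\varepsilon \to X$ is a compact operator and $\|(T - \lambda I)|_{Y_\varepsilon}\| < \varepsilon$. -/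

import Mathlib

/-- A half-space of a complex Banach space: a norm-closed linear subspace of infinite dimension
and infinite codimension. -/
structure IsHalfSpace {X : Type*} [NormedAddCommGroup X] [NormedSpace ℂ X]
    (Y : Submodule ℂ X) : Prop where
  isClosed : IsClosed (Y : Set X)
  infinite_dim : ¬ FiniteDimensional ℂ Y
  infinite_codim : ¬ FiniteDimensional ℂ (X ⧸ Y)

/-- `Y` is almost invariant under `T`: there is a finite-dimensional subspace `M` with
`T Y ⊆ Y + M`. -/
def IsAlmostInvariant {X : Type*} [NormedAddCommGroup X] [NormedSpace ℂ X]
    (T : X →L[ℂ] X) (Y : Submodule ℂ X) : Prop :=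
  ∃ M : Submodule ℂ X, FiniteDimensional ℂ M ∧ ∀ y ∈ Y, T y ∈ Y ⊔ M

/-- The restriction of `T - z I` to `Y`, as a bounded operator `Y → X`. -/
noncomputable def restrictSub {X : Type*} [NormedAddCommGroup X] [NormedSpace ℂ X]
    (T : X →L[ℂ] X) (z : ℂ) (Y : Submodule ℂ X) : Y →L[ℂ] X :=
  (T - z • ContinuousLinearMap.id ℂ X).comp Y.subtypeL

/-! Put `S = T - z`, which is injective. Resolvents blow up near the boundary point `z`, so by
Banach–Steinhaus they blow up along some vector `e`. The normalized images `x n` satisfy `S (x n) →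
0` and `T (x n) ∈ span {x n, e}`, so closed spans of the `x n` are almost invariant with defect `ℂ ∙
e`.

It remains to pick a subsequence with bounded coordinates (`exists_subseq_coeff_bound`). Let `ξ` be
a weak-* limit of `x n` in the bidual. Injectivity of `S` makes `ξ` zero or places it outside `X`,
so `x n - ξ` is weak-* null and bounded away from zero, and Mazur's selection applies to it. Bounded
coordinates extend to functionals `f n` by Hahn–Banach. On the closed span `S` is then the series of
rank-one operators `f n ⊗ S (x n)`, which is compact and as small as desired. Keeping only even
terms leaves infinite codimension. -/

/-- The unit sphere of a finite-dimensional subspace is compact. -/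
theorem isCompact_submodule_inter_sphere {V : Type*} [NormedAddCommGroup V] [NormedSpace ℂ V]
    (F : Submodule ℂ V) [FiniteDimensional ℂ F] : IsCompact {w : V | w ∈ F ∧ ‖w‖ = 1} := by
  have : ProperSpace F := FiniteDimensional.proper ℂ F
  convert (isCompact_sphere (0 : F) 1).image continuous_subtype_val using 1
  ext w
  simp [and_comm]

/-! ### Mazur's selection -/

open Filter Topology in
/-- **Mazur's selection step.** If `u n → 0` weak-* along an ultrafilter and `u` is bounded away
from zero, then eventually adding multiples of `u n` to elements of a fixed finite-dimensional
subspace of the dual hardly decreases their norm. -/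
theorem eventually_norm_le_norm_add_smul {E ι : Type*} [NormedAddCommGroup E] [NormedSpace ℂ E]
    (U : Ultrafilter ι) {u : ι → StrongDual ℂ E} {δ : ℝ} (hδ : 0 < δ) (hu : ∀ i, δ ≤ ‖u i‖)
    (h0 : ∀ φ : E, Tendsto (fun i => u i φ) U (𝓝 0))
    (F : Submodule ℂ (StrongDual ℂ E)) [FiniteDimensional ℂ F] {r : ℝ} (hr : 1 < r) :
    ∀ᶠ i in (U : Filter ι), ∀ w ∈ F, ∀ a : ℂ, ‖w‖ ≤ r * ‖w + a • u i‖ := by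
  by_contra hcon
  rw [← Ultrafilter.eventually_not] at hcon
  have key : ∀ i, ∃ w : StrongDual ℂ E, ∃ a : ℂ, (¬ ∀ w ∈ F, ∀ a : ℂ, ‖w‖ ≤ r * ‖w + a • u i‖) →
      (w ∈ F ∧ ‖w‖ = 1) ∧ r * ‖w + a • u i‖ < 1 := by
    intro i
    by_cases h : ∀ w ∈ F, ∀ a : ℂ, ‖w‖ ≤ r * ‖w + a • u i‖
    · exact ⟨0, 0, fun h' => absurd h h'⟩
    · push Not at h
      obtain ⟨w, hw, a, hwa⟩ := h
      have hpos : 0 < ‖w‖ := lt_of_le_of_lt (by positivity) hwa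
      have hc : ‖((‖w‖ : ℂ))⁻¹‖ = ‖w‖⁻¹ := by simp
      refine ⟨((‖w‖ : ℂ))⁻¹ • w, (‖w‖ : ℂ)⁻¹ * a,
        fun _ => ⟨⟨F.smul_mem _ hw, ?_⟩, ?_⟩⟩
      · rw [norm_smul, hc]
        exact inv_mul_cancel₀ hpos.ne'
      · have hfac : (‖w‖ : ℂ)⁻¹ • w + ((‖w‖ : ℂ)⁻¹ * a) • u i = (‖w‖ : ℂ)⁻¹ • (w + a • u i) := by
          rw [mul_smul]
          exact (smul_add _ _ _).symm
        rw [hfac, norm_smul, hc, mul_left_comm, inv_mul_lt_iff₀ hpos]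
        simpa using hwa
  choose w a hwa using key
  have hev : ∀ᶠ i in (U : Filter ι),
      (w i ∈ F ∧ ‖w i‖ = 1) ∧ r * ‖w i + a i • u i‖ < 1 :=
    hcon.mono fun i hi => hwa i hi
  obtain ⟨w₀, hw₀, hlim⟩ := (isCompact_submodule_inter_sphere F).ultrafilter_le_nhds
    (U.map w) (by
      rw [le_principal_iff]
      exact hev.mono fun i hi => hi.1)
  have hlim' : Tendsto w U (𝓝 w₀) := hlim
  have hw₀' : ‖w₀‖ = 1 := hw₀.2
  have hr0 : 0 < r := by linarith
  -- The lower bound `δ` keeps the scalars bounded, so `a i • u i` is still weak-* null and `w i + a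
  -- i • u i` tends weak-* to `w₀`.
  have ha : ∀ᶠ i in (U : Filter ι), ‖a i‖ ≤ 2 / δ := by
    filter_upwards [hev] with i hi
    have h1 : ‖w i + a i • u i‖ < 1 := by
      have := norm_nonneg (w i + a i • u i)
      nlinarith [hi.2]
    have h2 : ‖a i • u i‖ ≤ 2 := by
      have h3 := norm_sub_le (w i + a i • u i) (w i)
      rw [add_sub_cancel_left] at h3
      have h4 : ‖w i‖ = 1 := hi.1.2
      linarith
    rw [norm_smul] at h2
    rw [le_div_iff₀ hδ]
    exact (mul_le_mul_of_nonneg_left (hu i) (norm_nonneg _)).trans h2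
  have hle : ‖w₀‖ ≤ r⁻¹ := by
    refine ContinuousLinearMap.opNorm_le_bound _ (by positivity) fun φ => ?_
    have t1 : Tendsto (fun i => w i φ) U (𝓝 (w₀ φ)) :=
      ((ContinuousLinearMap.apply ℂ ℂ φ).continuous.tendsto w₀).comp hlim'
    have t2 : Tendsto (fun i => a i * u i φ) U (𝓝 0) := by
      refine squeeze_zero_norm' (a := fun i => 2 / δ * ‖u i φ‖) ?_ ?_
      · filter_upwards [ha] with i hi
        rw [norm_mul]
        gcongr
      · simpa using (h0 φ).norm.const_mul (2 / δ)
    have t3 := (t1.add t2).norm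
    rw [add_zero] at t3
    refine le_of_tendsto t3 ?_
    filter_upwards [hev] with i hi
    have h5 := (w i + a i • u i).le_opNorm φ
    have h6 : ‖w i + a i • u i‖ ≤ r⁻¹ := by
      rw [← one_div, le_div_iff₀ hr0]
      linarith [hi.2]
    refine le_trans ?_ (mul_le_mul_of_nonneg_right h6 (norm_nonneg φ))
    simpa using h5
  rw [hw₀'] at hle
  exact absurd hle (not_le.2 (inv_lt_one_of_one_lt₀ hr))

/-- Coefficients of a sequence whose successive partial spans satisfy the basic-sequence
inequality with constants telescoping to at most two. -/
theorem norm_coeff_le_of_weighted {V : Type*} [NormedAddCommGroup V] [NormedSpace ℂ V]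
    {u : ℕ → V} {F : ℕ → Submodule ℂ V} {c : ℕ → ℝ} (hF : Monotone F)
    (huF : ∀ n, u n ∈ F (n + 1)) (hc1 : ∀ n, 1 ≤ c n) (hc2 : ∀ n, c n ≤ 2)
    (h : ∀ n, ∀ w ∈ F n, ∀ a : ℂ, c (n + 1) * ‖w‖ ≤ c n * ‖w + a • u n‖)
    {w : V} (hw : w ∈ F 0) (a : ℕ → ℂ) {n m : ℕ} (hnm : n < m) :
    ‖a n‖ * ‖u n‖ ≤ 4 * ‖w + ∑ i ∈ Finset.range m, a i • u i‖ := by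
  set s : ℕ → V := fun k => w + ∑ i ∈ Finset.range k, a i • u i with hs
  have hsucc : ∀ k, s (k + 1) = s k + a k • u k := fun k => by
    simp [hs, Finset.sum_range_succ, add_assoc]
  have hmem : ∀ k, s k ∈ F k := by
    intro k
    induction k with
    | zero => simpa [hs] using hw
    | succ k ih =>
      rw [hsucc]
      exact add_mem (hF k.le_succ ih) (Submodule.smul_mem _ _ (huF k))
  -- That is, `‖s k‖ / c k` is nondecreasing in `k`.
  have hmono : ∀ j k, j ≤ k → c k * ‖s j‖ ≤ c j * ‖s k‖ := by
    intro j k hjk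
    induction k, hjk using Nat.le_induction with
    | base => exact le_rfl
    | succ k hk ih =>
      have h1 := h k (s k) (hmem k) (a k)
      rw [← hsucc] at h1
      have hk0 : 0 < c k := by linarith [hc1 k]
      have hk1 : 0 < c (k + 1) := by linarith [hc1 (k + 1)]
      have hj0 : 0 < c j := by linarith [hc1 j]
      refine le_of_mul_le_mul_left ?_ hk0
      nlinarith [mul_le_mul_of_nonneg_left ih hk1.le, mul_le_mul_of_nonneg_left h1 hj0.le]
  have hbound : ∀ j, j ≤ m → ‖s j‖ ≤ 2 * ‖s m‖ := fun j hj => by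
    nlinarith [hmono j m hj, norm_nonneg (s j), norm_nonneg (s m), hc1 m, hc2 j,
      mul_le_mul_of_nonneg_right (hc1 m) (norm_nonneg (s j)),
      mul_le_mul_of_nonneg_right (hc2 j) (norm_nonneg (s m))]
  have h1 : a n • u n = s (n + 1) - s n := by rw [hsucc]; abel
  rw [← norm_smul, h1]
  linarith [norm_sub_le (s (n + 1)) (s n), hbound n hnm.le, hbound (n + 1) hnm]

/-- Inductive selection of a subsequence with uniformly bounded coordinates relative to a fixed
vector `ξ`. -/
theorem exists_subseq_norm_coeff_le {V : Type*} [NormedAddCommGroup V] [NormedSpace ℂ V]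
    (u : ℕ → V) (ξ : V) (P : ℕ → ℕ → Prop)
    (h : ∀ (n : ℕ) (F : Submodule ℂ V) [FiniteDimensional ℂ F] (r : ℝ), 1 < r →
      ∃ i, P n i ∧ ∀ w ∈ F, ∀ a : ℂ, ‖w‖ ≤ r * ‖w + a • u i‖) :
    ∃ k : ℕ → ℕ, (∀ n, P n (k n)) ∧ ∀ (a : ℕ → ℂ) (b : ℂ) (n m : ℕ), n < m →
      ‖a n‖ * ‖u (k n)‖ ≤ 4 * ‖b • ξ + ∑ i ∈ Finset.range m, a i • u (k i)‖ := by
  -- Strictly decreasing, so each step has a ratio `c n / c (n + 1) > 1` to spend, while the product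
  -- of all ratios stays at most 2.
  let c : ℕ → ℝ := fun n => 1 + 1 / (n + 1)
  have hc1 : ∀ n, 1 ≤ c n := fun n => le_add_of_nonneg_right (by positivity)
  have hc2 : ∀ n, c n ≤ 2 := fun n => by
    have : (1 : ℝ) / (n + 1) ≤ 1 := by
      rw [div_le_one (by positivity)]
      exact le_add_of_nonneg_left n.cast_nonneg
    simp only [c]
    linarith
  have hclt : ∀ n, c (n + 1) < c n := fun n => by
    simp only [c]
    gcongr
    simp
  have step : ∀ (n : ℕ) (F : {F : Submodule ℂ V // FiniteDimensional ℂ F}), ∃ i : ℕ, P n i ∧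
      ∀ w ∈ F.1, ∀ a : ℂ, c (n + 1) * ‖w‖ ≤ c n * ‖w + a • u i‖ := by
    rintro n ⟨F, hF⟩
    have hpos : 0 < c (n + 1) := by linarith [hc1 (n + 1)]
    obtain ⟨i, h2, h1⟩ := h n F (c n / c (n + 1)) ((one_lt_div hpos).2 (hclt n))
    refine ⟨i, h2, fun w hw a => ?_⟩
    have := h1 w hw a
    rwa [div_mul_eq_mul_div, le_div_iff₀ hpos, mul_comm] at this
  choose g hg1 hg2 using step
  -- Starting from `ℂ ∙ ξ` makes the bounds independent of the coefficient of `ξ`.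
  let F : ℕ → {F : Submodule ℂ V // FiniteDimensional ℂ F} :=
    fun n => Nat.rec ⟨ℂ ∙ ξ, inferInstance⟩
      (fun n F => ⟨F.1 ⊔ (ℂ ∙ u (g n F)), by have := F.2; infer_instance⟩) n
  have hFsucc : ∀ n, (F (n + 1)).1 = (F n).1 ⊔ (ℂ ∙ u (g n (F n))) := fun n => rfl
  have hmono : Monotone fun n => (F n).1 :=
    monotone_nat_of_le_succ fun n => by rw [hFsucc]; exact le_sup_left
  have huF : ∀ n, u (g n (F n)) ∈ (F (n + 1)).1 := fun n => by
    rw [hFsucc]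
    exact Submodule.mem_sup_right (Submodule.mem_span_singleton_self _)
  exact ⟨fun n => g n (F n), fun n => hg1 n (F n), fun a b n m hnm =>
    norm_coeff_le_of_weighted (u := fun i => u (g i (F i))) hmono huF hc1 hc2
      (fun n => hg2 n (F n))
      (Submodule.smul_mem _ b (Submodule.mem_span_singleton_self ξ)) a hnm⟩

/-! ### Bounded coordinates via the bidual -/

open Filter Topology in
/-- A bounded family has a weak-* limit in the bidual along every ultrafilter. -/
theorem exists_bidual_ultralimit {X ι : Type*} [NormedAddCommGroup X] [NormedSpace ℂ X]
    (U : Ultrafilter ι) {x : ι → X} {r : ℝ} (hx : ∀ i, ‖x i‖ ≤ r) :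
    ∃ ξ : StrongDual ℂ (StrongDual ℂ X),
      ∀ φ : StrongDual ℂ X, Tendsto (fun i => φ (x i)) U (𝓝 (ξ φ)) := by
  let v : ι → WeakDual ℂ (StrongDual ℂ X) := fun i =>
    StrongDual.toWeakDual (NormedSpace.inclusionInDoubleDual ℂ X (x i))
  have hv : ∀ i, v i ∈ WeakDual.toStrongDual ⁻¹'
      Metric.closedBall (0 : StrongDual ℂ (StrongDual ℂ X)) r := fun i => by
    refine Set.mem_preimage.2 ((mem_closedBall_zero_iff
      (E := StrongDual ℂ (StrongDual ℂ X))).2 ?_)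
    exact (NormedSpace.double_dual_bound ℂ X (x i)).trans (hx i)
  obtain ⟨ξ, -, hξ⟩ := (WeakDual.isCompact_closedBall (𝕜 := ℂ)
    (0 : StrongDual ℂ (StrongDual ℂ X)) r).ultrafilter_le_nhds (U.map v)
    (tendsto_principal.2 (Eventually.of_forall hv))
  exact ⟨WeakDual.toStrongDual ξ, fun φ => ((WeakDual.eval_continuous φ).tendsto ξ).comp hξ⟩

/-- Unit vectors of a complete isometric copy of `X` stay away from every point which is either
zero or outside that copy. -/
theorem exists_pos_le_norm_map_sub {X V ι : Type*} [NormedAddCommGroup X] [NormedSpace ℂ X]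
    [CompleteSpace X] [NormedAddCommGroup V] [NormedSpace ℂ V] (J : X →ₗᵢ[ℂ] V) {ξ : V} {x : ι → X}
    (hx : ∀ i, ‖x i‖ = 1) (hξ : ∀ y, J y = ξ → y = 0) :
    ∃ δ : ℝ, 0 < δ ∧ ∀ i, δ ≤ ‖J (x i) - ξ‖ := by
  by_cases hmem : ξ ∈ Set.range J
  · obtain ⟨y, rfl⟩ := hmem
    refine ⟨1, one_pos, fun i => ?_⟩
    simp [hξ y rfl, hx]
  · have hcl : IsClosed (Set.range J) := J.isometry.isClosedEmbedding.isClosed_range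
    refine ⟨Metric.infDist ξ (Set.range J),
      (hcl.notMem_iff_infDist_pos ⟨_, Set.mem_range_self 0⟩).1 hmem, fun i => ?_⟩
    have := Metric.infDist_le_dist_of_mem (x := ξ) (Set.mem_range_self (f := J) (x i))
    rwa [dist_comm, dist_eq_norm] at this

/-- Selection of a subsequence with uniformly bounded coordinates, relative to an isometric
embedding `J : X → V` and a point `ξ` of `V`. -/
theorem exists_subseq_coeff_bound_of_embedding {X V : Type*} [NormedAddCommGroup X]
    [NormedSpace ℂ X] [CompleteSpace X] [NormedAddCommGroup V] [NormedSpace ℂ V] (J : X →ₗ[ℂ] V)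
    (hJ : ∀ y, ‖J y‖ = ‖y‖) {ξ : V} (hξ : ∀ y, J y = ξ → y = 0) {x : ℕ → X} (hx : ∀ n, ‖x n‖ = 1)
    (U : Filter ℕ) [U.NeBot]
    (hU : ∀ δ : ℝ, 0 < δ → (∀ i, δ ≤ ‖J (x i) - ξ‖) →
      ∀ (F : Submodule ℂ V) [FiniteDimensional ℂ F] (r : ℝ), 1 < r →
        ∀ᶠ i in U, ∀ w ∈ F, ∀ a : ℂ, ‖w‖ ≤ r * ‖w + a • (J (x i) - ξ)‖) :
    ∃ C : ℝ, 0 < C ∧ ∀ P : ℕ → ℕ → Prop, (∀ n, ∀ᶠ i in U, P n i) → ∃ k : ℕ → ℕ,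
      (∀ n, P n (k n)) ∧
      ∀ (a : ℕ →₀ ℂ) (n : ℕ),
        ‖a n‖ ≤ C * ‖Finsupp.linearCombination ℂ (fun i => x (k i)) a‖ := by
  obtain ⟨δ, hδ, hu⟩ := exists_pos_le_norm_map_sub (⟨J, hJ⟩ : X →ₗᵢ[ℂ] V) hx hξ
  refine ⟨4 / δ, by positivity, fun P hP => ?_⟩
  obtain ⟨k, hk, hcoeff⟩ := exists_subseq_norm_coeff_le (fun i => J (x i) - ξ) ξ P
    fun n F hF r hr => ((hP n).and (hU δ hδ hu F r hr)).exists
  refine ⟨k, hk, fun a n => ?_⟩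
  obtain ⟨m, hm⟩ := (insert n a.support).bddAbove
  have hn : n < m + 1 := Nat.lt_succ_of_le (hm (by simp))
  have hsum : Finsupp.linearCombination ℂ (fun i => x (k i)) a =
      ∑ i ∈ Finset.range (m + 1), a i • x (k i) := by
    rw [Finsupp.linearCombination_apply]
    refine Finsupp.sum_of_support_subset _ (fun i hi => ?_) _ (by simp)
    exact Finset.mem_range.2 (Nat.lt_succ_of_le (hm (by simp [Finsupp.mem_support_iff.1 hi])))
  have hfin := hcoeff a (∑ i ∈ Finset.range (m + 1), a i) n (m + 1) hn
  have hJsum : J (∑ i ∈ Finset.range (m + 1), a i • x (k i)) =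
      (∑ i ∈ Finset.range (m + 1), a i) • ξ +
        ∑ i ∈ Finset.range (m + 1), a i • (J (x (k i)) - ξ) := by
    simp [smul_sub, Finset.sum_sub_distrib, Finset.sum_smul]
  rw [← hJsum, hJ, ← hsum] at hfin
  rw [div_mul_eq_mul_div, le_div_iff₀ hδ]
  exact (mul_le_mul_of_nonneg_left (hu _) (norm_nonneg _)).trans hfin

open Filter Topology in
/-- From almost null vectors of an injective operator one can select a subsequence along which the
images are as small as prescribed and the coordinates are uniformly bounded. -/
theorem exists_subseq_coeff_bound {X : Type*} [NormedAddCommGroup X] [NormedSpace ℂ X]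
    [CompleteSpace X] {S : X →L[ℂ] X} (hS : Function.Injective S) {x : ℕ → X}
    (hx : ∀ n, ‖x n‖ = 1) (hSx : Tendsto (fun n => S (x n)) atTop (𝓝 0)) :
    ∃ C : ℝ, 0 < C ∧ ∀ τ : ℕ → ℝ, (∀ n, 0 < τ n) → ∃ k : ℕ → ℕ,
      (∀ n, ‖S (x (k n))‖ ≤ τ n) ∧
      ∀ (a : ℕ →₀ ℂ) (n : ℕ),
        ‖a n‖ ≤ C * ‖Finsupp.linearCombination ℂ (fun i => x (k i)) a‖ := by
  have hU : (hyperfilter ℕ : Filter ℕ) ≤ atTop := Nat.hyperfilter_le_atTop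
  obtain ⟨ξ, hξ⟩ := exists_bidual_ultralimit (hyperfilter ℕ) fun n => (hx n).le
  have hξ0 : ∀ y : X, NormedSpace.inclusionInDoubleDual ℂ X y = ξ → y = 0 := by
    intro y hy
    refine hS ?_
    rw [map_zero]
    refine SeparatingDual.eq_zero_of_forall_dual_eq_zero (R := ℂ) fun φ => ?_
    -- Testing the limit on `φ ∘ S` shows that `S y` is the weak limit of `S (x n)`, hence zero.
    have t1 : Tendsto (fun n => φ (S (x n))) (hyperfilter ℕ) (𝓝 (φ (S y))) := by
      have := hξ (φ.comp S)
      rw [← hy] at this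
      exact this
    have t2 : Tendsto (fun n => φ (S (x n))) (hyperfilter ℕ) (𝓝 0) := by
      have := ((φ.continuous.tendsto 0).comp hSx).mono_left hU
      rwa [map_zero] at this
    exact tendsto_nhds_unique t1 t2
  obtain ⟨C, hC, h⟩ := exists_subseq_coeff_bound_of_embedding
    (V := StrongDual ℂ (StrongDual ℂ X)) (NormedSpace.inclusionInDoubleDual ℂ X).toLinearMap
    (NormedSpace.inclusionInDoubleDualLi (E := X) ℂ).norm_map hξ0 hx (hyperfilter ℕ)
    fun δ hδ hu F hF r hr =>
      eventually_norm_le_norm_add_smul (hyperfilter ℕ) hδ hu (fun φ => by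
        have := (hξ φ).sub_const (ξ φ)
        rw [sub_self] at this
        exact this) F hr
  refine ⟨C, hC, fun τ hτ => h (fun n i => ‖S (x i)‖ ≤ τ n) fun n => ?_⟩
  have := hSx.norm.mono_left hU
  rw [norm_zero] at this
  exact (this.eventually_lt_const (hτ n)).mono fun i hi => hi.le

/-! ### Biorthogonal functionals, half-spaces and compactness -/

/-- Bounded coordinates give bounded biorthogonal functionals. -/
theorem exists_biorthogonal {X : Type*} [NormedAddCommGroup X] [NormedSpace ℂ X] {y : ℕ → X}
    {C : ℝ} (hC : 0 < C)
    (hy : ∀ (a : ℕ →₀ ℂ) (n : ℕ), ‖a n‖ ≤ C * ‖Finsupp.linearCombination ℂ y a‖) :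
    ∃ f : ℕ → StrongDual ℂ X, (∀ n, ‖f n‖ ≤ C) ∧
      ∀ n m, f n (y m) = if n = m then 1 else 0 := by
  have hli : LinearIndependent ℂ y := by
    rw [linearIndependent_iff]
    intro a ha
    ext n
    have := hy a n
    rw [ha, norm_zero, mul_zero] at this
    simpa using this
  have key : ∀ n, ∃ f : StrongDual ℂ X, ‖f‖ ≤ C ∧ ∀ m, f (y m) = if n = m then 1 else 0 := by
    intro n
    let f₀ : StrongDual ℂ (Submodule.span ℂ (Set.range y)) :=
      LinearMap.mkContinuous ((Finsupp.lapply n).comp hli.repr) C fun v => by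
        have := hy (hli.repr v) n
        rw [hli.linearCombination_repr] at this
        exact this
    obtain ⟨f, hf, hfn⟩ := exists_extension_norm_eq _ f₀
    refine ⟨f, hfn ▸ LinearMap.mkContinuous_norm_le _ hC.le _, fun m => ?_⟩
    have hm : y m ∈ Submodule.span ℂ (Set.range y) := Submodule.subset_span ⟨m, rfl⟩
    rw [show f (y m) = f₀ ⟨y m, hm⟩ from hf ⟨y m, hm⟩]
    show hli.repr ⟨y m, hm⟩ n = _
    rw [hli.repr_eq_single m ⟨y m, hm⟩ rfl, Finsupp.single_apply]
    simp [eq_comm]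
  choose f hf using key
  exact ⟨f, fun n => (hf n).1, fun n => (hf n).2⟩

/-- A family of vectors admitting biorthogonal functionals is linearly independent. -/
theorem linearIndependent_of_biorthogonal {V : Type*} [AddCommGroup V] [Module ℂ V]
    {v : ℕ → V} (f : ℕ → V →ₗ[ℂ] ℂ) (h : ∀ n m, f n (v m) = if n = m then 1 else 0) :
    LinearIndependent ℂ v := by
  rw [linearIndependent_iff]
  intro a ha
  ext n
  have := congrArg (f n) ha
  rw [Finsupp.linearCombination_apply, Finsupp.sum, map_sum, map_zero] at this
  simpa [h] using this

/-- The closed span of every second term of a sequence with biorthogonal functionals is a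
half-space. -/
theorem isHalfSpace_closure_span_even {X : Type*} [NormedAddCommGroup X] [NormedSpace ℂ X]
    {y : ℕ → X} {f : ℕ → StrongDual ℂ X} (hf : ∀ n m, f n (y m) = if n = m then 1 else 0) :
    IsHalfSpace (Submodule.span ℂ (Set.range fun n => y (2 * n))).topologicalClosure := by
  set Y := (Submodule.span ℂ (Set.range fun n => y (2 * n))).topologicalClosure with hY
  have hmem : ∀ n, y (2 * n) ∈ Y := fun n =>
    Submodule.le_topologicalClosure _ (Submodule.subset_span ⟨n, rfl⟩)
  -- The odd functionals vanish on `Y`, so they descend to the quotient and separate the odd vectors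
  -- there.
  have hker : ∀ n, Y ≤ LinearMap.ker (f (2 * n + 1) : X →ₗ[ℂ] ℂ) := by
    intro n
    refine Submodule.topologicalClosure_minimal _ ?_ (f (2 * n + 1)).isClosed_ker
    rw [Submodule.span_le]
    rintro _ ⟨m, rfl⟩
    have : f (2 * n + 1) (y (2 * m)) = 0 := by rw [hf, if_neg (by omega)]
    exact this
  refine ⟨Submodule.isClosed_topologicalClosure _, fun hfin => ?_, fun hfin => ?_⟩
  · have hli : LinearIndependent ℂ (fun n => (⟨y (2 * n), hmem n⟩ : Y)) :=
      linearIndependent_of_biorthogonal (fun n => (f (2 * n) : X →ₗ[ℂ] ℂ).comp Y.subtype)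
        fun n m => by simp [hf]
    exact not_finite_iff_infinite.2 inferInstance hli.finite
  · have hli : LinearIndependent ℂ (fun n => Y.mkQ (y (2 * n + 1))) :=
      linearIndependent_of_biorthogonal (fun n => Y.liftQ (f (2 * n + 1) : X →ₗ[ℂ] ℂ) (hker n))
        fun n m => by
          rw [Submodule.mkQ_apply, Submodule.liftQ_apply]
          simp [hf]
    exact not_finite_iff_infinite.2 inferInstance hli.finite

/-- A norm-summable series of rank-one operators is compact. -/
theorem isCompactOperator_tsum_smulRight {X Z : Type*} [NormedAddCommGroup X] [NormedSpace ℂ X]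
    [NormedAddCommGroup Z] [NormedSpace ℂ Z] [CompleteSpace Z] {f : ℕ → StrongDual ℂ X} {v : ℕ → Z}
    (h : Summable fun n => (f n).smulRight (v n)) :
    IsCompactOperator (∑' n, (f n).smulRight (v n) : X →L[ℂ] Z) := by
  refine isCompactOperator_of_tendsto h.hasSum (Filter.Eventually.of_forall fun s => ?_)
  refine Submodule.sum_mem (compactOperator (RingHom.id ℂ) X Z) fun n _ => ?_
  exact (isCompactOperator_of_locallyCompactSpace_dom (f n)).clm_comp
    (ContinuousLinearMap.toSpanSingleton ℂ (v n))

/-- An operator which is small on a sequence with bounded biorthogonal functionals is compact and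
small on the closed span. -/
theorem isCompactOperator_and_norm_le_of_biorthogonal {X Z : Type*} [NormedAddCommGroup X]
    [NormedSpace ℂ X] [NormedAddCommGroup Z] [NormedSpace ℂ Z] [CompleteSpace Z]
    (S : X →L[ℂ] Z) {y : ℕ → X} {f : ℕ → StrongDual ℂ X}
    (hf : ∀ n m, f n (y m) = if n = m then 1 else 0) {b : ℕ → ℝ} {B : ℝ} (hb : HasSum b B)
    (hfb : ∀ n, ‖f n‖ * ‖S (y n)‖ ≤ b n) :
    IsCompactOperator
        (S.comp (Submodule.span ℂ (Set.range y)).topologicalClosure.subtypeL) ∧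
      ‖S.comp (Submodule.span ℂ (Set.range y)).topologicalClosure.subtypeL‖ ≤ B := by
  set Y := (Submodule.span ℂ (Set.range y)).topologicalClosure
  have hle : ∀ n, ‖(f n).smulRight (S (y n))‖ ≤ b n := fun n => by
    rw [ContinuousLinearMap.norm_smulRight_apply]
    exact hfb n
  have hsum : Summable fun n => (f n).smulRight (S (y n)) :=
    Summable.of_norm_bounded hb.summable hle
  set A : X →L[ℂ] Z := ∑' n, (f n).smulRight (S (y n))
  have hA : ‖A‖ ≤ B := tsum_of_norm_bounded hb hle
  have hAS : S.comp Y.subtypeL = A.comp Y.subtypeL := by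
    have heq : Set.EqOn S A (Set.range y) := by
      rintro _ ⟨m, rfl⟩
      have h1 := (ContinuousLinearMap.apply ℂ Z (y m)).hasSum hsum.hasSum
      have h2 : HasSum (fun n => ((f n).smulRight (S (y n))) (y m)) (S (y m)) := by
        convert hasSum_ite_eq m (S (y m)) using 2 with n
        rw [ContinuousLinearMap.smulRight_apply, hf]
        split_ifs with h
        · rw [h, one_smul]
        · rw [zero_smul]
      exact h2.unique h1
    ext v
    exact ContinuousLinearMap.eqOn_closure_span heq v.2
  rw [hAS]
  refine ⟨(isCompactOperator_tsum_smulRight hsum).comp_clm Y.subtypeL, ?_⟩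
  refine (A.opNorm_comp_le _).trans ?_
  calc ‖A‖ * ‖Y.subtypeL‖ ≤ ‖A‖ * 1 := by gcongr; exact Y.norm_subtypeL_le
    _ ≤ B := by rwa [mul_one]

/-! ### Approximate eigenvectors and almost invariance -/

open Filter Topology in
/-- At a boundary point `z` of the spectrum there are approximate eigenvectors, namely normalized
resolvent images of a single vector `e`, which `T - z` maps into the span of themselves and `e`. -/
theorem exists_approx_null_vectors_of_mem_frontier {X : Type*} [NormedAddCommGroup X]
    [NormedSpace ℂ X] [CompleteSpace X] (T : X →L[ℂ] X) {z : ℂ}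
    (hz : z ∈ frontier (spectrum ℂ T)) :
    ∃ (e : X) (x : ℕ → X) (l m : ℕ → ℂ), (∀ n, ‖x n‖ = 1) ∧
      (∀ n, (T - z • ContinuousLinearMap.id ℂ X) (x n) = l n • x n + m n • e) ∧
      Tendsto (fun n => (T - z • ContinuousLinearMap.id ℂ X) (x n)) atTop (𝓝 0) := by
  have hzσ : z ∈ spectrum ℂ T := (spectrum.isClosed T).frontier_subset hz
  have hzρ : z ∈ closure (spectrum ℂ T)ᶜ := by
    rw [frontier_eq_closure_inter_closure] at hz
    exact hz.2
  obtain ⟨w, hw, hwz⟩ := mem_closure_iff_seq_limit.1 hzρ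
  have hunit : ∀ n, IsUnit (algebraMap ℂ (X →L[ℂ] X) (w n) - T) := fun n =>
    spectrum.notMem_iff.1 (hw n)
  choose r hr using hunit
  let R : ℕ → X →L[ℂ] X := fun n => ↑(r n)⁻¹
  have hR : ∀ n v, T (R n v) = w n • R n v - v := fun n v => by
    have h1 : (algebraMap ℂ (X →L[ℂ] X) (w n) - T) * R n = 1 := by
      rw [← hr]; exact (r n).mul_inv
    have h2 := congrArg (fun A : X →L[ℂ] X => A v) h1
    simp only [mul_apply_eq_comp, sub_apply,
      one_apply_eq_self, Algebra.algebraMap_eq_smul_one,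
      smul_apply] at h2
    exact eq_sub_of_add_eq (sub_eq_iff_eq_add'.1 h2).symm
  -- Otherwise `z - T` would be so close to the invertible `w n - T` as to be invertible.
  have hRlow : ∀ n, 1 ≤ ‖R n‖ * ‖w n - z‖ := by
    intro n
    by_contra hlt
    push Not at hlt
    refine hzσ ?_
    show IsUnit (algebraMap ℂ (X →L[ℂ] X) z - T)
    have hn : ‖algebraMap ℂ (X →L[ℂ] X) z - T - r n‖ < ‖(↑(r n)⁻¹ : X →L[ℂ] X)‖⁻¹ := by
      rw [hr, sub_sub_sub_cancel_right, ← map_sub, Algebra.algebraMap_eq_smul_one, norm_smul]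
      have hpos : 0 < ‖R n‖ := by
        refine (norm_nonneg _).lt_of_ne' fun h0 => ?_
        have hR0 : R n = 0 := norm_eq_zero.1 h0
        refine hzσ ?_
        have h1 : (r n : X →L[ℂ] X) * R n = 1 := (r n).mul_inv
        rw [hR0, mul_zero] at h1
        have := subsingleton_of_zero_eq_one h1
        exact isUnit_of_subsingleton _
      refine lt_of_le_of_lt (mul_le_of_le_one_right (norm_nonneg _)
        ContinuousLinearMap.norm_id_le) ?_
      rw [norm_sub_rev, ← one_div, lt_div_iff₀ hpos, mul_comm]
      exact hlt
    exact ((r n).ofNearby _ hn).isUnit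
  have hwz0 : Tendsto (fun n => ‖w n - z‖) atTop (𝓝 0) := by
    have := (hwz.sub_const z).norm
    simpa using this
  obtain ⟨e, he⟩ : ∃ e, ∀ C, ∃ n, C < ‖R n e‖ := by
    by_contra hcon
    push Not at hcon
    obtain ⟨C, hC⟩ := banach_steinhaus hcon
    have : Tendsto (fun n => C * ‖w n - z‖) atTop (𝓝 0) := by simpa using hwz0.const_mul C
    obtain ⟨n, hn⟩ := (this.eventually_lt_const one_pos).exists
    exact absurd ((hRlow n).trans (mul_le_mul_of_nonneg_right (hC n) (norm_nonneg _)))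
      (not_le.2 hn)
  -- Large values must recur, so that they can be combined with `w n` being near `z`.
  have hfreq : ∀ C : ℝ, ∃ᶠ n in atTop, C < ‖R n e‖ := by
    intro C hC
    have hbdd : IsBoundedUnder (· ≤ ·) atTop fun n => ‖R n e‖ :=
      ⟨C, eventually_map.2 (hC.mono fun n hn => not_lt.1 hn)⟩
    obtain ⟨D, hD⟩ := hbdd.bddAbove_range
    obtain ⟨n, hn⟩ := he D
    exact absurd (hD ⟨n, rfl⟩) (not_le.2 hn)
  have hsel : ∀ n : ℕ, ∃ i, ((n : ℝ) + 1 < ‖R i e‖) ∧ ‖w i - z‖ < 1 / ((n : ℝ) + 1) := fun n =>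
    ((hfreq _).and_eventually (hwz0.eventually_lt_const (by positivity))).exists
  choose i hi1 hi2 using hsel
  have hpos : ∀ n, 0 < ‖R (i n) e‖ := fun n => lt_trans (by positivity) (hi1 n)
  let x : ℕ → X := fun n => (‖R (i n) e‖ : ℂ)⁻¹ • R (i n) e
  have hx : ∀ n, ‖x n‖ = 1 := fun n => by
    rw [norm_smul]
    simp [(hpos n).ne']
  have hS : ∀ n, (T - z • ContinuousLinearMap.id ℂ X) (x n) =
      (w (i n) - z) • x n + (-(‖R (i n) e‖ : ℂ)⁻¹) • e := fun n => by
    simp only [x, sub_apply, smul_apply,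
      ContinuousLinearMap.id_apply, map_smul, hR]
    module
  refine ⟨e, x, fun n => w (i n) - z, fun n => -(‖R (i n) e‖ : ℂ)⁻¹, hx, hS, ?_⟩
  have hlim := (tendsto_one_div_add_atTop_nhds_zero_nat (𝕜 := ℝ)).mul_const (1 + ‖e‖)
  rw [zero_mul] at hlim
  refine squeeze_zero_norm (fun n => ?_) hlim
  rw [hS, mul_add, mul_one]
  refine (norm_add_le _ _).trans (add_le_add ?_ ?_)
  · rw [norm_smul, hx, mul_one]
    exact (hi2 n).le
  · rw [norm_smul]
    gcongr
    rw [norm_neg, norm_inv, Complex.norm_real, norm_norm, one_div]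
    gcongr
    exact (hi1 n).le

/-- If a family is mapped by `T` into `span {v i} + ℂ e`, then its closed span is almost invariant
under `T`. -/
theorem isAlmostInvariant_closure_span {X ι : Type*} [NormedAddCommGroup X] [NormedSpace ℂ X]
    (T : X →L[ℂ] X) {y : ι → X} {e : X} {l m : ι → ℂ} (h : ∀ i, T (y i) = l i • y i + m i • e) :
    IsAlmostInvariant T (Submodule.span ℂ (Set.range y)).topologicalClosure := by
  set Y := (Submodule.span ℂ (Set.range y)).topologicalClosure
  refine ⟨ℂ ∙ e, inferInstance, ?_⟩
  -- Closedness reduces the inclusion to the generators.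
  have hcl : IsClosed ((Y ⊔ (ℂ ∙ e) : Submodule ℂ X) : Set X) :=
    Submodule.isClosed_sup_finiteDimensional _ _ (Submodule.isClosed_topologicalClosure _)
  have hle : Y ≤ (Y ⊔ (ℂ ∙ e)).comap (T : X →ₗ[ℂ] X) := by
    refine Submodule.topologicalClosure_minimal _ ?_ (hcl.preimage T.continuous)
    rw [Submodule.span_le]
    rintro _ ⟨i, rfl⟩
    show T (y i) ∈ Y ⊔ (ℂ ∙ e)
    rw [h]
    refine Submodule.add_mem_sup (Submodule.smul_mem _ _ ?_)
      (Submodule.smul_mem _ _ (Submodule.mem_span_singleton_self e))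
    exact Submodule.le_topologicalClosure _ (Submodule.subset_span ⟨i, rfl⟩)
  exact fun y hy => hle hy

theorem proposition3p2 {X : Type*} [NormedAddCommGroup X] [NormedSpace ℂ X] [CompleteSpace X]
    (T : X →L[ℂ] X) (z : ℂ) (hz : z ∈ frontier (spectrum ℂ T))
    (hev : ¬ Module.End.HasEigenvalue (T : X →ₗ[ℂ] X) z) (ε : ℝ) (hε : 0 < ε) :
    ∃ Y : Submodule ℂ X, IsHalfSpace Y ∧ IsAlmostInvariant T Y ∧
      IsCompactOperator (restrictSub T z Y) ∧ ‖restrictSub T z Y‖ < ε := by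
  set S : X →L[ℂ] X := T - z • ContinuousLinearMap.id ℂ X with hSdef
  have hS : Function.Injective S := by
    rw [injective_iff_map_eq_zero]
    intro v hv
    by_contra hv0
    refine hev (Module.End.hasEigenvalue_of_hasEigenvector (x := v)
      (Module.End.hasEigenvector_iff.2 ⟨Module.End.mem_eigenspace_iff.2 ?_, hv0⟩))
    simpa [hSdef, sub_eq_zero] using hv
  obtain ⟨e, x, l, m, hx, hSx, hlim⟩ := exists_approx_null_vectors_of_mem_frontier T hz
  obtain ⟨C, hC, hsel⟩ := exists_subseq_coeff_bound hS hx hlim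
  -- Only even indices are used, whence `n / 2`. Multiplied by `C`, the even tolerances sum to `ε /
  -- 2`, leaving room for the strict inequality.
  obtain ⟨k, hk, hcoeff⟩ := hsel (fun n => ε / 2 / C / 2 / 2 ^ (n / 2)) fun n => by positivity
  obtain ⟨f, hfC, hf⟩ := exists_biorthogonal hC hcoeff
  have hsum : HasSum (fun n : ℕ => C * (ε / 2 / C / 2 / 2 ^ n)) (C * (ε / 2 / C)) :=
    (hasSum_geometric_two' _).mul_left C
  rw [mul_div_cancel₀ _ hC.ne'] at hsum
  obtain ⟨hcomp, hnorm⟩ := isCompactOperator_and_norm_le_of_biorthogonal S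
    (y := fun n => x (k (2 * n))) (f := fun n => f (2 * n)) (fun n i => by simp [hf]) hsum
    fun n => by
      have := hk (2 * n)
      rw [Nat.mul_div_cancel_left n two_pos] at this
      exact mul_le_mul (hfC _) this (norm_nonneg _) hC.le
  refine ⟨_, isHalfSpace_closure_span_even hf,
    isAlmostInvariant_closure_span T (e := e) (l := fun n => l (k (2 * n)) + z)
      (m := fun n => m (k (2 * n))) fun n => ?_, hcomp, hnorm.trans_lt (by linarith)⟩
  have h1 := hSx (k (2 * n))
  rw [sub_apply, sub_eq_iff_eq_add] at h1
  rw [h1]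
  simp only [smul_apply, ContinuousLinearMap.id_apply]
  module
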